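/- Let $n\in\mathbb N$, let $\mathcal K\subset\mathbb R^n$ be closed, and let $F:\mathbb R^n\rightrightarrows\mathbb R^n$ be a multifunction satisfying (F1) $F(x)$ is nonempty, convex and compact for every $x\in\mathbb R^n$; (F2) for each compact $C\subset\mathbb R^n$ there is $L>0$ with $F(x)\subset F(y)+L|y-x|\,\overline{\mathbb B}$ for all $x,y\in C$, where $\overline{\mathbb B}$ is the closed unit ball; (F3) there is $\gamma>0$ with $|v|\le\gamma(1+|x|)$ for all $x\in\mathbb R^n$ and $v\in F(x)$. A trajectory of $F$ on $[0,T]$ starting at $x$ is an absolutely continuous $x(\cdot):[0,T]\to\mathbb R^n$ with $x(0)=x$ and $\dot x(t)\in F(x(t))$ for a.e. $t\in[0,T]$. The minimum time function $\mathcal T:\mathbb R^n\to[0,+\infty]$ is defined by $\mathcal T(x)=0$ if $x\in\mathcal K$ and, if $x\notin\mathcal K$, by $$\mathcal T(x)=\inf\{T>0:\ \text{there is a trajectory } x(\cdot) \text{ of } F \text{ on } [0,T] \text{ starting at } x \text{ with } x(T)\in\mathcal K\},\qquad \inf\emptyset=+\infty.$$ Put $\mathcal R=\{x:\mathcal T(x)<+\infty\}$,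 $\mathcal R(t)=\{x:\mathcal T(x)\le t\}$, and $h(x,\zeta)=\min_{v\in F(x)}\langle v,\zeta\rangle$. For a subset $S$ of a Euclidean space and $x\in S$, let $N^P_S(x)$ be the set of all $v$ for which there is $\sigma\ge0$ with $\langle v,y-x\rangle\le\sigma|y-x|^2$ for all $y\in S$. Let $\mathrm{epi}(\mathcal T)=\{(x,\beta)\in\mathbb R^n\times\mathbb R:\beta\ge\mathcal T(x)\}$, and for $x\in\mathcal R$ let $$\partial^\infty\mathcal T(x)=\{\zeta\in\mathbb R^n:(\zeta,0)\in N^P_{\mathrm{epi}(\mathcal T)}(x,\mathcal T(x))\}$$ be the proximal horizontal subdifferential of $\mathcal T$ at $x$. Then for every $x_0\in\mathcal R\setminus\mathcal K$, $$\partial^\infty\mathcal T(x_0)=N^P_{\mathcal R(\mathcal T(x_0))}(x_0)\cap\{\zeta\in\mathbb R^n:h(x_0,\zeta)=0\}.$$ -/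

import Mathlib

open scoped Pointwise

noncomputable section

/-- The proximal normal cone to a set `S` at a point `x ∈ S`: all `v` such that, for some `σ ≥ 0`,
`⟨v, y - x⟩ ≤ σ |y - x|²` for all `y ∈ S`. -/
def proximalNormalCone {E : Type*} [NormedAddCommGroup E] [InnerProductSpace ℝ E]
    (S : Set E) (x : E) : Set E :=
  {v | ∃ σ : ℝ, 0 ≤ σ ∧ ∀ y ∈ S, inner ℝ v (y - x) ≤ σ * ‖y - x‖ ^ 2}

/-- The epigraph of an extended real valued function, as a subset of `E × ℝ` with the Euclidean
(Hilbert) product structure. Since `β` is real, only points of the domain of `f` occur. -/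
def epigraph {E : Type*} (f : E → EReal) : Set (WithLp 2 (E × ℝ)) :=
  {p | f p.fst ≤ (p.snd : EReal)}

/-- The horizontal proximal subdifferential of `f` at a point `x` where `f x` is a real number `r`:
all `v` such that `(v, 0)` is a proximal normal to the epigraph of `f` at `(x, r)`. -/
def horizontalProximalSubdifferential {E : Type*} [NormedAddCommGroup E] [InnerProductSpace ℝ E]
    (f : E → EReal) (x : E) : Set E :=
  {v | ∃ r : ℝ, f x = (r : EReal) ∧
    WithLp.toLp 2 (v, (0 : ℝ)) ∈ proximalNormalCone (epigraph f) (WithLp.toLp 2 (x, r))}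

/-- The standing assumption (F) on a multifunction `F` of `ℝⁿ`: nonempty compact convex values,
local Lipschitz continuity and linear growth. -/
structure AssumptionF {n : ℕ} (F : EuclideanSpace ℝ (Fin n) → Set (EuclideanSpace ℝ (Fin n))) :
    Prop where
  nonempty : ∀ x, (F x).Nonempty
  convex : ∀ x, Convex ℝ (F x)
  compact : ∀ x, IsCompact (F x)
  locallyLipschitz : ∀ C : Set (EuclideanSpace ℝ (Fin n)), IsCompact C →
    ∃ L : ℝ, 0 < L ∧ ∀ x ∈ C, ∀ y ∈ C, F x ⊆ F y + Metric.closedBall 0 (L * ‖y - x‖)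
  linearGrowth : ∃ γ : ℝ, 0 < γ ∧ ∀ x, ∀ v ∈ F x, ‖v‖ ≤ γ * (1 + ‖x‖)

/-- `x` restricted to `[0, T]` is a trajectory of `F` starting at `x₀`: it is absolutely continuous
on `[0, T]`, its derivative at `t` belongs to `F (x t)` for almost every `t ∈ [0, T]`, and
`x 0 = x₀`. (The end points form a null set, so they can be left out.) -/
def IsTrajectory {n : ℕ} (F : EuclideanSpace ℝ (Fin n) → Set (EuclideanSpace ℝ (Fin n)))
    (x₀ : EuclideanSpace ℝ (Fin n)) (T : ℝ) (x : ℝ → EuclideanSpace ℝ (Fin n)) : Prop :=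
  AbsolutelyContinuousOnInterval x 0 T ∧
  (∀ᵐ t ∂MeasureTheory.volume, t ∈ Set.Ioo 0 T → ∃ v ∈ F (x t), HasDerivAt x v t) ∧
  x 0 = x₀

open Classical in
/-- The minimum time function of `F` for the target `K`, with values in `[0, +∞]`: it is `0` on `K`,
and off `K` it is the infimum of all times `T > 0` at which some trajectory starting at `x₀` is
in `K` (`⊤` if there is none). -/
def minTime {n : ℕ} (F : EuclideanSpace ℝ (Fin n) → Set (EuclideanSpace ℝ (Fin n)))
    (K : Set (EuclideanSpace ℝ (Fin n))) (x₀ : EuclideanSpace ℝ (Fin n)) : EReal :=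
  if x₀ ∈ K then 0
  else sInf {τ : EReal | ∃ T : ℝ, τ = (T : EReal) ∧ 0 < T ∧
    ∃ x : ℝ → EuclideanSpace ℝ (Fin n), IsTrajectory F x₀ T x ∧ x T ∈ K}

/-- The sublevel set `{x | minTime x ≤ t}`, the reachable set at time `t`. -/
def reachableSetAt {n : ℕ} (F : EuclideanSpace ℝ (Fin n) → Set (EuclideanSpace ℝ (Fin n)))
    (K : Set (EuclideanSpace ℝ (Fin n))) (t : EReal) : Set (EuclideanSpace ℝ (Fin n)) :=
  {x | minTime F K x ≤ t}

/-- The reachable set `{x | minTime x < +∞}`. -/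
def reachableSet {n : ℕ} (F : EuclideanSpace ℝ (Fin n) → Set (EuclideanSpace ℝ (Fin n)))
    (K : Set (EuclideanSpace ℝ (Fin n))) : Set (EuclideanSpace ℝ (Fin n)) :=
  {x | minTime F K x < ⊤}

/-- The minimized Hamiltonian `h(x, ζ) = min_{v ∈ F x} ⟨v, ζ⟩`. The minimum is attained when `F x`
is nonempty and compact. -/
def minHamiltonian {n : ℕ} (F : EuclideanSpace ℝ (Fin n) → Set (EuclideanSpace ℝ (Fin n)))
    (x ζ : EuclideanSpace ℝ (Fin n)) : ℝ :=
  sInf ((fun v => inner ℝ v ζ) '' F x)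

end

open Set Filter Topology MeasureTheory

/-! Let `r = minTime F K x₀`. Testing a horizontal normal `ζ` at epigraph points of height `r` shows
that it is normal to the sublevel set. `h ≥ 0` (`minHamiltonian_nonneg`): each `v ∈ F x₀` is the
final velocity of trajectories arriving at `x₀`. Their starting points `x₀ - t v + o(t)` have
minimum time at most `r + t`, so the normal inequality divided by `t` gives `⟨v, ζ⟩ ≥ 0`. `h ≤ 0`
(`minHamiltonian_nonpos`): a nearly optimal trajectory from `x₀` is in the sublevel set after a
short time `t`. Normality bounds its displacement along `ζ` by `O(t²)`, while the Lipschitz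
condition bounds it below by `t h - O(t²)`. Converse: from `y` with minimum time at most `β = r +
δ`, `δ > 0`, a nearly optimal trajectory enters the sublevel set within time `2δ`. Normality applies
at the entry point, and `h = 0` makes the displacement from `y` at least `-O(|y - x₀|² + δ²)` along
`ζ`. Nearly optimal trajectories suffice throughout; the infimum need not be attained. -/

theorem AbsolutelyContinuousOnInterval.mul_sub_le_sub_of_ae_hasDerivAt {g : ℝ → ℝ} {a b c : ℝ}
    (hab : a ≤ b) (hg : AbsolutelyContinuousOnInterval g a b)
    (h : ∀ᵐ t, t ∈ Ioo a b → ∃ d, HasDerivAt g d t ∧ c ≤ d) :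
    c * (b - a) ≤ g b - g a := by
  rw [← hg.integral_deriv_eq_sub]
  have h1 : ∫ _ in a..b, c = c * (b - a) := by simp [mul_comm]
  rw [← h1]
  refine intervalIntegral.integral_mono_ae_restrict hab (by simp) hg.intervalIntegrable_deriv ?_
  rw [Measure.restrict_congr_set Ioo_ae_eq_Icc.symm]
  filter_upwards [(ae_restrict_iff' measurableSet_Ioo).2 h] with t ⟨d, hd, hcd⟩
  rwa [hd.deriv]

theorem LipschitzWith.comp_absolutelyContinuousOnInterval {X Y : Type*} [PseudoMetricSpace X]
    [PseudoMetricSpace Y] {φ : X → Y} {C : NNReal} (hφ : LipschitzWith C φ) {x : ℝ → X} {a b : ℝ}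
    (hx : AbsolutelyContinuousOnInterval x a b) :
    AbsolutelyContinuousOnInterval (fun t => φ (x t)) a b := by
  have h := Tendsto.const_mul (C : ℝ) hx
  rw [mul_zero] at h
  refine squeeze_zero (fun t => Finset.sum_nonneg fun i _ => dist_nonneg) (fun t => ?_) h
  rw [Finset.mul_sum]
  exact Finset.sum_le_sum fun i _ => hφ.dist_le_mul _ _

/-! ### Peano existence by delayed equations and compactness -/

section Peano

variable {E : Type*} [NormedAddCommGroup E] [NormedSpace ℝ E]

theorem lipschitzWith_add_intervalIntegral [CompleteSpace E] {g : ℝ → E} (hg : Continuous g)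
    {M : NNReal} (hM : ∀ t, ‖g t‖ ≤ M) (x₀ : E) :
    LipschitzWith M (fun t => x₀ + ∫ s in (0 : ℝ)..t, g s) := by
  refine LipschitzWith.of_dist_le_mul fun a b => ?_
  rw [dist_add_left, dist_eq_norm, intervalIntegral.integral_interval_sub_left
    (hg.intervalIntegrable _ _) (hg.intervalIntegrable _ _), dist_comm, Real.dist_eq, abs_sub_comm]
  exact intervalIntegral.norm_integral_le_of_norm_le_const fun t _ => hM t

/-- Tonelli's scheme: the delayed equation `u' (t) = f (u (t - τ))` is solvable on `[0, 1]`. -/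
theorem exists_delayed_solution [CompleteSpace E] {f : E → E} (hf : Continuous f) {M : NNReal}
    (hM : ∀ x, ‖f x‖ ≤ M) (x₀ : E) {τ : ℝ} (hτ : 0 < τ) :
    ∃ u : ℝ → E, LipschitzWith M u ∧
      ∀ t ∈ Icc (0 : ℝ) 1, u t = x₀ + ∫ s in (0 : ℝ)..t, f (u (max (s - τ) 0)) := by
  let Φ : (ℝ → E) → ℝ → E := fun u t => x₀ + ∫ s in (0 : ℝ)..t, f (u (max (s - τ) 0))
  -- Because of the delay, `Φ u` on `[0, (j + 1) τ]` depends only on `u` on `[0, j τ]`, so the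
  -- iterates become stationary.
  let w : ℕ → ℝ → E := fun j => Φ^[j] (fun _ => x₀)
  have hw : ∀ j, w (j + 1) = Φ (w j) := fun j => Function.iterate_succ_apply' _ _ _
  have hlip : ∀ j, LipschitzWith M (w j) := by
    intro j
    induction j with
    | zero => exact (LipschitzWith.const x₀).weaken zero_le
    | succ j ih =>
      rw [hw]
      have hc := ih.continuous
      exact lipschitzWith_add_intervalIntegral (g := fun s => f (w j (max (s - τ) 0)))
        (by fun_prop) (fun t => hM _) x₀
  have hstab : ∀ j : ℕ, ∀ t, 0 ≤ t → t ≤ j * τ → w (j + 1) t = w j t := by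
    intro j
    induction j with
    | zero =>
      intro t h0 h1
      have : t = 0 := le_antisymm (by simpa using h1) h0
      subst this
      rw [hw]
      simp [Φ, w]
    | succ j ih =>
      intro t h0 h1
      rw [congrFun (hw (j + 1)) t, congrFun (hw j) t]
      simp only [Φ]
      congr 1
      refine intervalIntegral.integral_congr fun s hs => ?_
      rw [uIcc_of_le h0] at hs
      rw [ih _ (le_max_right _ _)]
      refine max_le ?_ (by positivity)
      push_cast at h1
      linarith [hs.2]
  obtain ⟨k, hk⟩ := exists_nat_ge (1 / τ)
  refine ⟨w k, hlip k, fun t ht => ?_⟩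
  rw [div_le_iff₀ hτ] at hk
  rw [← hstab k t ht.1 (ht.2.trans hk), hw]

/-- **Peano's existence theorem** for a bounded continuous vector field. -/
theorem exists_hasDerivAt_of_continuous_of_bounded [FiniteDimensional ℝ E] {f : E → E}
    (hf : Continuous f) {M : NNReal} (hM : ∀ x, ‖f x‖ ≤ M) (x₀ : E) :
    ∃ x : ℝ → E, x 0 = x₀ ∧ LipschitzWith M x ∧
      ∀ t ∈ Icc (0 : ℝ) 1, HasDerivAt x (f (x t)) t := by
  have : ProperSpace E := FiniteDimensional.proper ℝ E
  have : CompleteSpace E := FiniteDimensional.complete ℝ E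
  choose u hul hu using fun k : ℕ =>
    exists_delayed_solution hf hM x₀ (τ := 1 / ((k : ℝ) + 1)) (by positivity)
  let U : ℕ → BoundedContinuousFunction (Icc (0 : ℝ) 1) E := fun k =>
    BoundedContinuousFunction.mkOfCompact
      ⟨fun t => u k t, (hul k).continuous.comp continuous_subtype_val⟩
  have hU : ∀ k t, U k t = u k t := fun k t => rfl
  have hu0 : ∀ k, u k 0 = x₀ := fun k => by
    rw [hu k 0 ⟨le_rfl, zero_le_one⟩]; simp
  have hcomp : IsCompact (closure (range U)) := by
    refine BoundedContinuousFunction.arzela_ascoli (Metric.closedBall x₀ M)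
      (isCompact_closedBall _ _) _ ?_ ?_
    · rintro _ t ⟨k, rfl⟩
      rw [Metric.mem_closedBall, hU, ← hu0 k]
      refine ((hul k).dist_le_mul _ _).trans ?_
      rw [Real.dist_eq, sub_zero, abs_of_nonneg t.2.1]
      exact mul_le_of_le_one_right M.2 t.2.2
    · refine (LipschitzWith.uniformEquicontinuous _ M ?_).equicontinuous
      rintro ⟨_, k, rfl⟩
      exact LipschitzWith.of_dist_le_mul fun a b => (hul k).dist_le_mul _ _
  obtain ⟨g, -, φ, hφ, hlim⟩ :=
    hcomp.tendsto_subseq (x := U) fun k => subset_closure (mem_range_self k)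
  have hlim' : ∀ t : Icc (0 : ℝ) 1, Tendsto (fun k => u (φ k) t) atTop (𝓝 (g t)) := fun t =>
    ((continuous_eval_const t).tendsto g).comp hlim
  -- Clamping extends the limit to `ℝ`, so its integral `x` has two-sided derivatives at `0` and `1`
  -- too.
  let z : ℝ → E := fun t => g (projIcc 0 1 zero_le_one t)
  have hz : Continuous z := g.continuous.comp continuous_projIcc
  let x : ℝ → E := fun t => x₀ + ∫ s in (0 : ℝ)..t, f (z s)
  have hxz : ∀ t ∈ Icc (0 : ℝ) 1, x t = z t := by
    intro t ht
    have hzt : Tendsto (fun k => u (φ k) t) atTop (𝓝 (z t)) := by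
      have := hlim' ⟨t, ht⟩
      simpa [z, projIcc_of_mem zero_le_one ht] using this
    refine tendsto_nhds_unique ?_ hzt
    simp_rw [fun k => hu (φ k) t ht]
    refine Tendsto.const_add x₀ ?_
    refine intervalIntegral.tendsto_integral_filter_of_dominated_convergence (fun _ => (M : ℝ))
      (Eventually.of_forall fun k => ?_) (Eventually.of_forall fun k => ?_) (by simp) ?_
    · have := (hul (φ k)).continuous
      exact Continuous.aestronglyMeasurable (by fun_prop)
    · exact Eventually.of_forall fun s _ => hM _
    · refine Eventually.of_forall fun s hs => (hf.tendsto _).comp ?_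
      rw [uIoc_of_le ht.1] at hs
      have hs' : s ∈ Icc (0 : ℝ) 1 := ⟨hs.1.le, hs.2.trans ht.2⟩
      have hzs : Tendsto (fun k => u (φ k) s) atTop (𝓝 (z s)) := by
        have := hlim' ⟨s, hs'⟩
        simpa [z, projIcc_of_mem zero_le_one hs'] using this
      have hd : Tendsto (fun k => (M : ℝ) * (1 / ((φ k : ℝ) + 1))) atTop (𝓝 0) := by
        have := (tendsto_one_div_add_atTop_nhds_zero_nat (𝕜 := ℝ)).comp hφ.tendsto_atTop
        simpa using this.const_mul (M : ℝ)
      refine (tendsto_iff_of_dist (squeeze_zero (fun _ => dist_nonneg) (fun k => ?_) hd)).1 hzs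
      refine ((hul (φ k)).dist_le_mul _ _).trans ?_
      refine mul_le_mul_of_nonneg_left ?_ M.2
      have h1 : (0 : ℝ) < 1 / ((φ k : ℝ) + 1) := by positivity
      rw [Real.dist_eq, abs_le]
      constructor
      · have : max (s - 1 / ((φ k : ℝ) + 1)) 0 ≤ s := max_le (by linarith) hs'.1
        linarith
      · have := le_max_left (s - 1 / ((φ k : ℝ) + 1)) 0
        linarith
  have hfz : Continuous fun s => f (z s) := hf.comp hz
  refine ⟨x, by simp [x], lipschitzWith_add_intervalIntegral hfz (fun t => hM _) x₀,
    fun t ht => ?_⟩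
  rw [hxz t ht]
  exact (intervalIntegral.integral_hasDerivAt_right (hfz.intervalIntegrable _ _)
    (hfz.stronglyMeasurableAtFilter _ _) hfz.continuousAt).const_add x₀

end Peano

/-- The nearest points of `v` in the values of a locally Lipschitz convex valued multifunction
depend continuously on the base point. -/
theorem continuousOn_of_inner_sub_le_zero {E : Type*} [NormedAddCommGroup E]
    [InnerProductSpace ℝ E] {F : E → Set E} {C : Set E} {L D : ℝ}
    (hF : ∀ x ∈ C, ∀ y ∈ C, F x ⊆ F y + Metric.closedBall 0 (L * ‖y - x‖)) {v : E} {p : E → E}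
    (hpF : ∀ x, p x ∈ F x) (hp : ∀ x, ∀ w ∈ F x, inner ℝ (v - p x) (w - p x) ≤ 0)
    (hD : ∀ x ∈ C, ‖v - p x‖ ≤ D) : ContinuousOn p C := by
  have key : ∀ x ∈ C, ∀ y ∈ C, inner ℝ (v - p x) (p y - p x) ≤ D * (L * ‖y - x‖) := by
    intro x hx y hy
    obtain ⟨w, hw, e, he, hwe⟩ := hF y hy x hx (hpF y)
    simp only at hwe
    have h1 : p y - p x = (w - p x) + e := by rw [← hwe]; abel
    rw [h1, inner_add_right]
    have h2 := real_inner_le_norm (v - p x) e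
    have h3 : ‖e‖ ≤ L * ‖y - x‖ := by rw [norm_sub_rev]; simpa using he
    have h4 : ‖v - p x‖ * ‖e‖ ≤ D * (L * ‖y - x‖) :=
      mul_le_mul (hD x hx) h3 (norm_nonneg _) ((norm_nonneg _).trans (hD x hx))
    linarith [hp x w hw]
  intro y hy
  have hlim : Tendsto (fun x => √(2 * (D * (L * ‖y - x‖)))) (𝓝[C] y) (𝓝 0) := by
    have hc : Continuous fun x => √(2 * (D * (L * ‖y - x‖))) := by fun_prop
    have := (hc.tendsto y).mono_left (nhdsWithin_le_nhds (s := C))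
    simpa using this
  rw [ContinuousWithinAt, tendsto_iff_norm_sub_tendsto_zero]
  refine squeeze_zero' (Eventually.of_forall fun x => norm_nonneg _) ?_ hlim
  filter_upwards [self_mem_nhdsWithin] with x hx
  refine Real.le_sqrt_of_sq_le ?_
  have h1 := key x hx y hy
  have h2 := key y hy x hx
  rw [norm_sub_rev x y] at h2
  -- Adding the two projection inequalities cancels `v` and gives a Hölder-1/2 modulus.
  have h3 : ‖p x - p y‖ ^ 2 = inner ℝ (v - p x) (p y - p x) + inner ℝ (v - p y) (p x - p y) := by
    rw [← real_inner_self_eq_norm_sq]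
    have : p y - p x = -(p x - p y) := by abel
    rw [this, inner_neg_right, neg_add_eq_sub, ← inner_sub_left]
    congr 1; abel
  linarith

/-! ### Trajectories: estimates, shift and concatenation -/

variable {n : ℕ} {F : EuclideanSpace ℝ (Fin n) → Set (EuclideanSpace ℝ (Fin n))}
  {K : Set (EuclideanSpace ℝ (Fin n))}

theorem minHamiltonian_le {x v : EuclideanSpace ℝ (Fin n)} (hc : IsCompact (F x))
    (hv : v ∈ F x) (ζ : EuclideanSpace ℝ (Fin n)) : minHamiltonian F x ζ ≤ inner ℝ v ζ :=
  csInf_le (hc.image (by fun_prop)).bddBelow (mem_image_of_mem _ hv)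

theorem le_minHamiltonian {x ζ : EuclideanSpace ℝ (Fin n)} {c : ℝ} (hne : (F x).Nonempty)
    (h : ∀ v ∈ F x, c ≤ inner ℝ v ζ) : c ≤ minHamiltonian F x ζ :=
  le_csInf (hne.image _) (by rintro _ ⟨v, hv, rfl⟩; exact h v hv)

namespace IsTrajectory

variable {x₀ : EuclideanSpace ℝ (Fin n)} {T : ℝ} {x : ℝ → EuclideanSpace ℝ (Fin n)}

theorem mul_le_inner_sub (hx : IsTrajectory F x₀ T x) {a b c : ℝ} (ha : 0 ≤ a) (hab : a ≤ b)
    (hb : b ≤ T) {ζ : EuclideanSpace ℝ (Fin n)}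
    (h : ∀ t ∈ Ioo a b, ∀ v ∈ F (x t), c ≤ inner ℝ v ζ) :
    c * (b - a) ≤ inner ℝ (x b - x a) ζ := by
  have hac : AbsolutelyContinuousOnInterval x a b := hx.1.mono (by
    rw [uIcc_of_le hab, uIcc_of_le (ha.trans (hab.trans hb))]
    exact Icc_subset_Icc ha hb)
  have hg : AbsolutelyContinuousOnInterval (fun t => inner ℝ (x t) ζ) a b := by
    simp_rw [real_inner_comm ζ]
    exact (innerSL ℝ ζ).lipschitz.comp_absolutelyContinuousOnInterval hac
  rw [inner_sub_left]
  refine hg.mul_sub_le_sub_of_ae_hasDerivAt hab ?_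
  filter_upwards [hx.2.1] with t ht htab
  obtain ⟨v, hv, hd⟩ := ht ⟨ha.trans_lt htab.1, htab.2.trans_le hb⟩
  refine ⟨inner ℝ v ζ, ?_, h t htab v hv⟩
  simp_rw [real_inner_comm ζ]
  exact (innerSL ℝ ζ).hasFDerivAt.comp_hasDerivAt t hd

theorem norm_sub_le (hx : IsTrajectory F x₀ T x) {a b M : ℝ} (ha : 0 ≤ a) (hab : a ≤ b)
    (hb : b ≤ T) (h : ∀ t ∈ Ioo a b, ∀ v ∈ F (x t), ‖v‖ ≤ M) (hM : 0 ≤ M) :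
    ‖x b - x a‖ ≤ M * (b - a) := by
  have h1 := hx.mul_le_inner_sub ha hab hb (ζ := -(x b - x a)) (c := -(M * ‖x b - x a‖)) (by
    intro t ht v hv
    rw [inner_neg_right, neg_le_neg_iff]
    exact (real_inner_le_norm _ _).trans (mul_le_mul_of_nonneg_right (h t ht v hv) (norm_nonneg _)))
  rw [inner_neg_right, real_inner_self_eq_norm_sq] at h1
  rcases (norm_nonneg (x b - x a)).eq_or_lt with h0 | h0
  · rw [← h0]; exact mul_nonneg hM (sub_nonneg.2 hab)
  · refine le_of_mul_le_mul_right ?_ h0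
    nlinarith

/-- A trajectory is bounded, so linear growth bounds its velocity. Shifting and gluing then only
need Lipschitz estimates. -/
theorem exists_lipschitz (hF : AssumptionF F) (hx : IsTrajectory F x₀ T x) (hT : 0 ≤ T) :
    ∃ M : NNReal, LipschitzOnWith M x (Icc 0 T) := by
  obtain ⟨γ, hγ, hg⟩ := hF.linearGrowth
  obtain ⟨B, hB⟩ := hx.1.exists_bound
  rw [uIcc_of_le hT] at hB
  have hB0 : 0 ≤ B := (norm_nonneg _).trans (hB 0 ⟨le_rfl, hT⟩)
  have hM0 : 0 ≤ γ * (1 + B) := by positivity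
  have key : ∀ a ∈ Icc 0 T, ∀ b ∈ Icc 0 T, a ≤ b → ‖x b - x a‖ ≤ γ * (1 + B) * (b - a) :=
    fun a ha b hb hab => hx.norm_sub_le ha.1 hab hb.2 (fun t ht v hv =>
      (hg _ v hv).trans (by gcongr; exact hB t ⟨ha.1.trans ht.1.le, ht.2.le.trans hb.2⟩)) hM0
  refine ⟨⟨γ * (1 + B), hM0⟩, LipschitzOnWith.of_dist_le_mul fun a ha b hb => ?_⟩
  change dist (x a) (x b) ≤ γ * (1 + B) * dist a b
  rcases le_total a b with hab | hab
  · rw [dist_comm, dist_eq_norm, Real.dist_eq, abs_sub_comm, abs_of_nonneg (sub_nonneg.2 hab)]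
    exact key a ha b hb hab
  · rw [dist_eq_norm, Real.dist_eq, abs_of_nonneg (sub_nonneg.2 hab)]
    exact key b hb a ha hab

/-- Replaces Gronwall: the maximum `m` of `‖x s - p‖` satisfies `m ≤ ‖x₀ - p‖ + t γ (1 + ‖p‖ + m)`,
and `t γ ≤ 1 / 2` absorbs the last term. -/
theorem norm_sub_le_of_linearGrowth (hx : IsTrajectory F x₀ T x) {γ : ℝ} (hγ : 0 < γ)
    (hg : ∀ x, ∀ v ∈ F x, ‖v‖ ≤ γ * (1 + ‖x‖)) (p : EuclideanSpace ℝ (Fin n)) {t : ℝ}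
    (ht0 : 0 ≤ t) (htT : t ≤ T) (ht : t * γ ≤ 1 / 2) {s : ℝ} (hs : s ∈ Icc 0 t) :
    ‖x s - p‖ ≤ 2 * (‖x₀ - p‖ + t * γ * (1 + ‖p‖)) := by
  have hcont : ContinuousOn (fun s => ‖x s - p‖) (Icc 0 t) := by
    have := hx.1.continuousOn
    rw [uIcc_of_le (ht0.trans htT)] at this
    exact ((this.mono (Icc_subset_Icc le_rfl htT)).sub continuousOn_const).norm
  obtain ⟨s₁, hs₁, hmax⟩ := isCompact_Icc.exists_isMaxOn (nonempty_Icc.2 ht0) hcont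
  set m := ‖x s₁ - p‖ with hm
  have hm0 : 0 ≤ m := norm_nonneg _
  have hle : ∀ s ∈ Icc 0 t, ‖x s - p‖ ≤ m := fun s hs => hmax hs
  have h1 : ‖x s₁ - x 0‖ ≤ γ * (1 + (‖p‖ + m)) * (s₁ - 0) := by
    refine hx.norm_sub_le le_rfl hs₁.1 (hs₁.2.trans htT) (fun r hr v hv => ?_) (by positivity)
    refine (hg _ v hv).trans ?_
    gcongr
    have h2 := norm_add_le p (x r - p)
    rw [add_sub_cancel] at h2
    exact h2.trans (by gcongr; exact hle r ⟨hr.1.le, hr.2.le.trans hs₁.2⟩)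
  rw [hx.2.2] at h1
  have h3 : m ≤ ‖x s₁ - x₀‖ + ‖x₀ - p‖ := norm_sub_le_norm_sub_add_norm_sub _ _ _
  have h4 : γ * (1 + (‖p‖ + m)) * (s₁ - 0) ≤ γ * (1 + (‖p‖ + m)) * t := by
    gcongr; linarith [hs₁.2]
  have h5 := hle s hs
  have h6 : t * γ * m ≤ 1 / 2 * m := by gcongr
  nlinarith

theorem shift (hF : AssumptionF F) (hx : IsTrajectory F x₀ T x) {t : ℝ} (ht : t ∈ Icc 0 T) :
    IsTrajectory F (x t) (T - t) (fun s => x (s + t)) := by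
  have h0 : 0 ≤ T - t := sub_nonneg.2 ht.2
  obtain ⟨M, hM⟩ := hx.exists_lipschitz hF (ht.1.trans ht.2)
  refine ⟨?_, ?_, by simp⟩
  · refine LipschitzOnWith.absolutelyContinuousOnInterval (K := M) ?_
    rw [uIcc_of_le h0]
    refine LipschitzOnWith.of_dist_le_mul fun a ha b hb => ?_
    rw [← dist_add_right a b t]
    exact hM.dist_le_mul _ ⟨by linarith [ha.1, ht.1], by linarith [ha.2]⟩ _
      ⟨by linarith [hb.1, ht.1], by linarith [hb.2]⟩
  · filter_upwards [(measurePreserving_add_right volume t).quasiMeasurePreserving.ae hx.2.1]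
      with s hs hsT
    obtain ⟨v, hv, hd⟩ := hs ⟨by linarith [hsT.1, ht.1], by linarith [hsT.2]⟩
    exact ⟨v, hv, hd.comp_add_const s t⟩

theorem concat (hF : AssumptionF F) {z : EuclideanSpace ℝ (Fin n)} {a : ℝ}
    {y : ℝ → EuclideanSpace ℝ (Fin n)} (hy : IsTrajectory F z a y) (ha : 0 ≤ a)
    (hx : IsTrajectory F (y a) T x) (hT : 0 ≤ T) :
    IsTrajectory F z (a + T) (fun s => if s ≤ a then y s else x (s - a)) := by
  obtain ⟨M, hM⟩ := hy.exists_lipschitz hF ha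
  obtain ⟨N, hN⟩ := hx.exists_lipschitz hF hT
  set w := fun s => if s ≤ a then y s else x (s - a) with hw
  have hwa : ∀ s, s ≤ a → w s = y s := fun s hs => if_pos hs
  have hwb : ∀ s, a ≤ s → w s = x (s - a) := by
    intro s hs
    rcases hs.eq_or_lt with rfl | hs
    · rw [hwa _ le_rfl, sub_self, hx.2.2]
    · exact if_neg hs.not_ge
  have h1 : LipschitzOnWith (max M N) w (Icc 0 a) := by
    refine LipschitzOnWith.of_dist_le_mul fun s hs t ht => ?_
    rw [hwa s hs.2, hwa t ht.2]
    exact (hM.weaken (le_max_left M N)).dist_le_mul _ hs _ ht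
  have h2 : LipschitzOnWith (max M N) w (Icc a (a + T)) := by
    refine LipschitzOnWith.of_dist_le_mul fun s hs t ht => ?_
    rw [hwb s hs.1, hwb t ht.1, ← dist_sub_right s t a]
    exact (hN.weaken (le_max_right M N)).dist_le_mul _
      ⟨by linarith [hs.1], by linarith [hs.2]⟩ _ ⟨by linarith [ht.1], by linarith [ht.2]⟩
  have h3 : ∀ s ∈ Icc 0 (a + T), ∀ t ∈ Icc 0 (a + T), s ≤ t →
      dist (w s) (w t) ≤ max M N * dist s t := by
    intro s hs t ht hst
    rcases le_total t a with hta | hta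
    · exact h1.dist_le_mul _ ⟨hs.1, hst.trans hta⟩ _ ⟨ht.1, hta⟩
    rcases le_total s a with hsa | hsa
    · have e1 := h1.dist_le_mul s ⟨hs.1, hsa⟩ a ⟨ha, le_rfl⟩
      have e2 := h2.dist_le_mul a ⟨le_rfl, by linarith⟩ t ⟨hta, ht.2⟩
      have e3 : dist s t = dist s a + dist a t := by
        simp only [Real.dist_eq]
        rw [abs_of_nonpos (by linarith), abs_of_nonpos (by linarith),
          abs_of_nonpos (by linarith)]
        ring
      rw [e3, mul_add]
      exact (dist_triangle _ _ _).trans (add_le_add e1 e2)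
    · exact h2.dist_le_mul _ ⟨hsa, hs.2⟩ _ ⟨hta, ht.2⟩
  refine ⟨?_, ?_, by rw [hwa 0 ha, hy.2.2]⟩
  · refine LipschitzOnWith.absolutelyContinuousOnInterval (K := max M N) ?_
    rw [uIcc_of_le (add_nonneg ha hT)]
    refine LipschitzOnWith.of_dist_le_mul fun s hs t ht => ?_
    rcases le_total s t with hst | hst
    · exact h3 s hs t ht hst
    · rw [dist_comm, dist_comm s]
      exact h3 t ht s hs hst
  · filter_upwards [hy.2.1,
      (measurePreserving_sub_right volume a).quasiMeasurePreserving.ae hx.2.1,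
      Measure.ae_ne volume a] with s hs1 hs2 hsa hs
    rcases lt_or_gt_of_ne hsa with h | h
    · obtain ⟨v, hv, hd⟩ := hs1 ⟨hs.1, h⟩
      rw [← hwa s h.le] at hv
      refine ⟨v, hv, hd.congr_of_eventuallyEq ?_⟩
      filter_upwards [eventually_lt_nhds h] with r hr
      exact hwa r hr.le
    · obtain ⟨v, hv, hd⟩ := hs2 ⟨by linarith, by linarith [hs.2]⟩
      rw [← hwb s h.le] at hv
      refine ⟨v, hv, (hd.comp_sub_const s a).congr_of_eventuallyEq ?_⟩
      filter_upwards [eventually_gt_nhds h] with r hr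
      exact hwb r hr.le

end IsTrajectory

/-! ### The minimum time function and dynamic programming -/

section minTime

variable {x₀ : EuclideanSpace ℝ (Fin n)} {T : ℝ} {x : ℝ → EuclideanSpace ℝ (Fin n)}

theorem minTime_of_mem (h : x₀ ∈ K) : minTime F K x₀ = 0 := if_pos h

theorem minTime_nonneg (F : EuclideanSpace ℝ (Fin n) → Set (EuclideanSpace ℝ (Fin n)))
    (K : Set (EuclideanSpace ℝ (Fin n))) (x₀ : EuclideanSpace ℝ (Fin n)) :
    0 ≤ minTime F K x₀ := by
  unfold minTime
  split_ifs
  · exact le_rfl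
  · refine le_sInf ?_
    rintro _ ⟨T, rfl, hT, -⟩
    exact_mod_cast hT.le

theorem IsTrajectory.minTime_le (hx : IsTrajectory F x₀ T x) (hT : 0 ≤ T) (hK : x T ∈ K) :
    minTime F K x₀ ≤ T := by
  by_cases h : x₀ ∈ K
  · rw [minTime_of_mem h]
    exact_mod_cast hT
  · rw [minTime, if_neg h]
    refine sInf_le ⟨T, rfl, hT.lt_of_ne ?_, x, hx, hK⟩
    rintro rfl
    exact h (hx.2.2 ▸ hK)

theorem exists_isTrajectory_of_minTime_lt (h : x₀ ∉ K) {c : ℝ} (hc : minTime F K x₀ < c) :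
    ∃ T : ℝ, 0 < T ∧ T < c ∧ minTime F K x₀ ≤ T ∧
      ∃ x : ℝ → EuclideanSpace ℝ (Fin n), IsTrajectory F x₀ T x ∧ x T ∈ K := by
  have hc' := hc
  rw [minTime, if_neg h, sInf_lt_iff] at hc'
  obtain ⟨_, ⟨T, rfl, hT, x, hx, hxK⟩, hTc⟩ := hc'
  exact ⟨T, hT, by exact_mod_cast hTc, hx.minTime_le hT.le hxK, x, hx, hxK⟩

theorem IsTrajectory.minTime_apply_le (hF : AssumptionF F) (hx : IsTrajectory F x₀ T x)
    (hK : x T ∈ K) {t : ℝ} (ht : t ∈ Icc 0 T) : minTime F K (x t) ≤ (T - t : ℝ) :=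
  (hx.shift hF ht).minTime_le (sub_nonneg.2 ht.2) (by simpa using hK)

theorem IsTrajectory.minTime_le_add (hF : AssumptionF F) (hx : IsTrajectory F x₀ T x)
    (hT : 0 ≤ T) {c : ℝ} (hc : minTime F K (x T) < c) : minTime F K x₀ ≤ (T + c : ℝ) := by
  by_cases h : x T ∈ K
  · refine (hx.minTime_le hT h).trans ?_
    have : (0 : EReal) < c := (minTime_nonneg F K (x T)).trans_lt hc
    have : 0 < c := by exact_mod_cast this
    exact_mod_cast (by linarith : T ≤ T + c)
  · obtain ⟨S, hS, hSc, -, y, hy, hyK⟩ := exists_isTrajectory_of_minTime_lt h hc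
    refine ((hx.concat hF hT hy hS.le).minTime_le (by linarith) ?_).trans
      (by exact_mod_cast (by linarith : T + S ≤ T + c))
    rw [if_neg (by linarith)]
    simpa using hyK

/-- Speed is bounded near `x₀`, so arbitrarily short travel times would put `x₀` in the closure of
`K`. -/
theorem minTime_pos (hF : AssumptionF F) (hK : IsClosed K) (h : x₀ ∉ K) :
    0 < minTime F K x₀ := by
  refine (minTime_nonneg F K x₀).lt_of_ne fun h0 => h ?_
  obtain ⟨γ, hγ, hg⟩ := hF.linearGrowth
  rw [← hK.closure_eq, Metric.mem_closure_iff]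
  intro ε hε
  set A := 2 * (γ * (1 + ‖x₀‖)) with hA
  have hA0 : 0 < A := by positivity
  have hc : minTime F K x₀ < (min (1 / 2 / γ) (ε / A) : ℝ) := by
    rw [← h0]
    exact_mod_cast lt_min (by positivity) (by positivity)
  obtain ⟨T, hT, hTc, -, x, hx, hxK⟩ := exists_isTrajectory_of_minTime_lt h hc
  refine ⟨x T, hxK, ?_⟩
  have h1 : T * γ ≤ 1 / 2 := (le_div_iff₀ hγ).1 (hTc.le.trans (min_le_left _ _))
  have h2 : T * A < ε := (lt_div_iff₀ hA0).1 (hTc.trans_le (min_le_right _ _))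
  have h3 := hx.norm_sub_le_of_linearGrowth hγ hg x₀ hT.le le_rfl h1 (right_mem_Icc.2 hT.le)
  rw [dist_comm, dist_eq_norm]
  rw [sub_self, norm_zero] at h3
  rw [hA] at h2
  linarith

end minTime

theorem mem_horizontalProximalSubdifferential_iff {E : Type*} [NormedAddCommGroup E]
    [InnerProductSpace ℝ E] {f : E → EReal} {x : E} {r : ℝ} (hr : f x = r) {v : E} :
    v ∈ horizontalProximalSubdifferential f x ↔ ∃ σ : ℝ, 0 ≤ σ ∧ ∀ (y : E) (β : ℝ), f y ≤ β →
      inner ℝ v (y - x) ≤ σ * (‖y - x‖ ^ 2 + (β - r) ^ 2) := by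
  constructor
  · rintro ⟨r', hr', σ, hσ, h⟩
    obtain rfl : r = r' := by exact_mod_cast hr.symm.trans hr'
    refine ⟨σ, hσ, fun y β hy => ?_⟩
    simpa [WithLp.prod_inner_apply, WithLp.prod_norm_sq_eq_of_L2] using
      h (WithLp.toLp 2 (y, β)) hy
  · rintro ⟨σ, hσ, h⟩
    refine ⟨r, hr, σ, hσ, fun p hp => ?_⟩
    simpa [WithLp.prod_inner_apply, WithLp.prod_norm_sq_eq_of_L2] using h p.fst p.snd hp

/-- Every `v ∈ F x₀` is the final velocity of trajectories of `F` arriving at `x₀`. -/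
theorem exists_isTrajectory_to (hF : AssumptionF F) {x₀ v : EuclideanSpace ℝ (Fin n)}
    (hv : v ∈ F x₀) :
    ∃ (M : NNReal) (y : ℝ → EuclideanSpace ℝ (Fin n)) (ε : ℝ), 0 < ε ∧ LipschitzWith M y ∧
      y 0 = x₀ ∧ HasDerivAt y (-v) 0 ∧
      ∀ t ∈ Icc 0 ε, IsTrajectory F (y t) t (fun s => y (t - s)) := by
  obtain ⟨γ, hγ, hg⟩ := hF.linearGrowth
  obtain ⟨L, -, hLip⟩ := hF.locallyLipschitz _ (isCompact_closedBall x₀ 1)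
  -- The nearest point to `v` is a selection of `F`, continuous near `x₀`, with value `v` at `x₀`.
  choose p hpF hpmin using fun x => exists_norm_eq_iInf_of_complete_convex (hF.nonempty x)
    (hF.compact x).isComplete (hF.convex x) v
  have hp : ∀ x, ∀ w ∈ F x, inner ℝ (v - p x) (w - p x) ≤ 0 := fun x =>
    (norm_eq_iInf_iff_real_inner_le_zero (hF.convex x) (hpF x)).1 (hpmin x)
  have hp₀ : p x₀ = v := by
    have h := hp x₀ v hv
    rw [real_inner_self_nonpos, sub_eq_zero] at h
    exact h.symm
  set B := γ * (1 + (‖x₀‖ + 1)) with hB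
  have hB0 : 0 ≤ B := by positivity
  have hpB : ∀ x ∈ Metric.closedBall x₀ 1, ‖p x‖ ≤ B := by
    intro x hx
    refine (hg x _ (hpF x)).trans ?_
    have := norm_le_norm_add_norm_sub' x x₀
    rw [Metric.mem_closedBall, dist_eq_norm] at hx
    rw [hB]
    gcongr
    linarith
  have hpc : ContinuousOn p (Metric.closedBall x₀ 1) :=
    continuousOn_of_inner_sub_le_zero hLip hpF hp (D := ‖v‖ + B) fun x hx =>
      (_root_.norm_sub_le _ _).trans (by gcongr; exact hpB x hx)
  -- Radial retraction onto the unit ball about `x₀`, making the field globally continuous and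
  -- bounded.
  let P : EuclideanSpace ℝ (Fin n) → EuclideanSpace ℝ (Fin n) :=
    fun x => x₀ + (max 1 ‖x - x₀‖)⁻¹ • (x - x₀)
  have hPc : Continuous P := by
    have : Continuous fun x : EuclideanSpace ℝ (Fin n) => (max 1 ‖x - x₀‖)⁻¹ :=
      Continuous.inv₀ (by fun_prop) fun x => (lt_max_of_lt_left one_pos).ne'
    fun_prop
  have hPm : ∀ x, P x ∈ Metric.closedBall x₀ 1 := by
    intro x
    have h1 : 0 < max 1 ‖x - x₀‖ := lt_max_of_lt_left one_pos
    rw [Metric.mem_closedBall, dist_eq_norm, add_sub_cancel_left, norm_smul, norm_inv,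
      Real.norm_of_nonneg h1.le, inv_mul_le_one₀ h1]
    exact le_max_right _ _
  have hPid : ∀ x ∈ Metric.closedBall x₀ 1, P x = x := by
    intro x hx
    rw [Metric.mem_closedBall, dist_eq_norm] at hx
    simp [P, max_eq_left hx]
  obtain ⟨y, hy0, hyl, hyd⟩ := exists_hasDerivAt_of_continuous_of_bounded
    (f := fun x => -p (P x)) (M := ⟨B, hB0⟩)
    (hpc.comp_continuous hPc hPm).neg (fun x => by rw [norm_neg]; exact hpB _ (hPm x)) x₀
  -- Up to time `1 / (B + 1)` the curve stays in the unit ball, where `P` is the identity. It solves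
  -- `y' = -p y`, so reversing time gives a trajectory of `F`.
  refine ⟨⟨B, hB0⟩, y, min 1 (1 / (B + 1)), by positivity, hyl, hy0, ?_, fun t ht => ?_⟩
  · have := hyd 0 (by simp)
    rwa [hy0, hPid x₀ (by simp), hp₀] at this
  · have hl : LipschitzWith ⟨B, hB0⟩ fun s => y (t - s) :=
      LipschitzWith.of_dist_le_mul fun a b => by
        rw [← dist_sub_left t a b]; exact hyl.dist_le_mul _ _
    refine ⟨hl.lipschitzOnWith.absolutelyContinuousOnInterval, ?_, by simp⟩
    refine Eventually.of_forall fun s hs => ?_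
    have hts : t - s ∈ Icc 0 (min 1 (1 / (B + 1))) :=
      ⟨by linarith [hs.2], by linarith [hs.1, ht.2]⟩
    have h1 := hyd (t - s) ⟨hts.1, hts.2.trans (min_le_left _ _)⟩
    have hmem : y (t - s) ∈ Metric.closedBall x₀ 1 := by
      rw [Metric.mem_closedBall, ← hy0]
      refine (hyl.dist_le_mul _ _).trans ?_
      rw [Real.dist_eq, sub_zero, abs_of_nonneg hts.1]
      change B * (t - s) ≤ 1
      have := (le_div_iff₀ (by positivity)).1 (hts.2.trans (min_le_right _ _))
      linarith [hts.1]
    rw [hPid _ hmem] at h1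
    refine ⟨p (y (t - s)), hpF _, ?_⟩
    simpa using h1.comp_const_sub t s

/-- Within distance `m` of `p`, every velocity is within `L * m` of `F p`, which costs at most `L *
m * ‖ζ‖` in the Hamiltonian. -/
theorem IsTrajectory.minHamiltonian_sub_mul_le (hF : AssumptionF F)
    {x₀ p ζ : EuclideanSpace ℝ (Fin n)} {T L R m t : ℝ} {x : ℝ → EuclideanSpace ℝ (Fin n)}
    (hx : IsTrajectory F x₀ T x) (hL : 0 ≤ L)
    (hLip : ∀ a ∈ Metric.closedBall p R, ∀ b ∈ Metric.closedBall p R,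
      F a ⊆ F b + Metric.closedBall 0 (L * ‖b - a‖))
    (ht : t ∈ Icc 0 T) (hm : ∀ s ∈ Icc 0 t, ‖x s - p‖ ≤ m) (hmR : m ≤ R) :
    (minHamiltonian F p ζ - L * m * ‖ζ‖) * t ≤ inner ℝ (x t - x₀) ζ := by
  have hR : 0 ≤ R := (norm_nonneg _).trans ((hm 0 ⟨le_rfl, ht.1⟩).trans hmR)
  have h := hx.mul_le_inner_sub le_rfl ht.1 ht.2 (ζ := ζ)
    (c := minHamiltonian F p ζ - L * m * ‖ζ‖) (fun s hs v hv => ?_)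
  · rwa [sub_zero, hx.2.2] at h
  have hms := hm s ⟨hs.1.le, hs.2.le⟩
  obtain ⟨w, hw, e, he, rfl⟩ := hLip (x s) (by simpa [dist_eq_norm] using hms.trans hmR) p
    (by simpa using hR) hv
  have he' : ‖e‖ ≤ L * m := by
    rw [mem_closedBall_zero_iff, norm_sub_rev] at he
    exact he.trans (by gcongr)
  have h1 := minHamiltonian_le (hF.compact p) hw ζ
  have h2 : -(L * m * ‖ζ‖) ≤ inner ℝ e ζ := by
    have h3 := (abs_le.1 (abs_real_inner_le_norm e ζ)).1
    have h4 : ‖e‖ * ‖ζ‖ ≤ L * m * ‖ζ‖ := by gcongr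
    linarith
  change _ ≤ inner ℝ (w + e) ζ
  rw [inner_add_left]
  linarith

/-! ### The Hamiltonian condition and the two inclusions -/

theorem minHamiltonian_nonneg (hF : AssumptionF F) {x₀ ζ : EuclideanSpace ℝ (Fin n)} {r : ℝ}
    (hr : minTime F K x₀ = r)
    (hζ : ζ ∈ horizontalProximalSubdifferential (minTime F K) x₀) :
    0 ≤ minHamiltonian F x₀ ζ := by
  obtain ⟨σ, hσ, h⟩ := (mem_horizontalProximalSubdifferential_iff hr).1 hζ
  refine le_minHamiltonian (hF.nonempty x₀) fun v hv => ?_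
  obtain ⟨M, y, ε, hε, hyl, hy0, hyd, hy⟩ := exists_isTrajectory_to hF hv
  have hlim : Tendsto (fun t : ℝ => inner ℝ ζ (t⁻¹ • (y t - x₀))) (𝓝[>] 0)
      (𝓝 (inner ℝ ζ (-v))) := by
    have := hyd.tendsto_slope_zero_right
    simp only [zero_add, hy0] at this
    exact tendsto_const_nhds.inner this
  have hlim2 : Tendsto (fun t : ℝ => σ * ((M : ℝ) ^ 2 + 4) * t) (𝓝[>] 0) (𝓝 0) := by
    have : Continuous fun t : ℝ => σ * ((M : ℝ) ^ 2 + 4) * t := by fun_prop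
    simpa using (this.tendsto 0).mono_left nhdsWithin_le_nhds
  have hle := le_of_tendsto_of_tendsto hlim hlim2 ?_
  · rw [inner_neg_right, real_inner_comm] at hle
    linarith
  filter_upwards [Ioo_mem_nhdsGT hε] with t ht
  -- The extra `t` is slack for the strict bound in `minTime_le_add`; the height excess `2t` still
  -- contributes only `4t²`.
  have h1 : minTime F K (y t) ≤ (t + (r + t) : ℝ) := by
    refine (hy t ⟨ht.1.le, ht.2.le⟩).minTime_le_add hF ht.1.le ?_
    rw [sub_self, hy0, hr]
    exact_mod_cast (by linarith [ht.1] : r < r + t)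
  have h2 := h (y t) _ h1
  have h3 : ‖y t - x₀‖ ≤ M * t := by
    have := hyl.dist_le_mul t 0
    rwa [hy0, dist_eq_norm, Real.dist_eq, sub_zero, abs_of_pos ht.1] at this
  rw [real_inner_smul_right, inv_mul_le_iff₀ ht.1]
  refine h2.trans ?_
  have h4 : ‖y t - x₀‖ ^ 2 ≤ (M * t) ^ 2 := by gcongr
  have h5 : σ * (‖y t - x₀‖ ^ 2 + (t + (r + t) - r) ^ 2)
      ≤ σ * ((M * t) ^ 2 + (t + (r + t) - r) ^ 2) := by gcongr
  refine h5.trans (le_of_eq ?_)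
  ring

theorem minHamiltonian_nonpos (hF : AssumptionF F) (hK : IsClosed K)
    {x₀ ζ : EuclideanSpace ℝ (Fin n)} (hx₀ : x₀ ∉ K) {r : ℝ} (hr : minTime F K x₀ = r)
    (hζ : ζ ∈ proximalNormalCone (reachableSetAt F K r) x₀) :
    minHamiltonian F x₀ ζ ≤ 0 := by
  obtain ⟨σ, hσ, h⟩ := hζ
  obtain ⟨γ, hγ, hg⟩ := hF.linearGrowth
  have hr0 : 0 < r := by
    have := minTime_pos hF hK hx₀
    rw [hr] at this
    exact_mod_cast this
  -- This radius dominates `A * t` once `t * γ ≤ 1 / 2`.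
  obtain ⟨L, hL, hLip⟩ := hF.locallyLipschitz _ (isCompact_closedBall x₀ (1 + ‖x₀‖))
  set A := 2 * (γ * (1 + ‖x₀‖)) with hA
  have hlim : Tendsto (fun t : ℝ => (σ * A ^ 2 + L * A * ‖ζ‖) * t) (𝓝[>] 0) (𝓝 0) := by
    have : Continuous fun t : ℝ => (σ * A ^ 2 + L * A * ‖ζ‖) * t := by fun_prop
    simpa using (this.tendsto 0).mono_left nhdsWithin_le_nhds
  refine ge_of_tendsto hlim ?_
  filter_upwards [Ioo_mem_nhdsGT (lt_min hr0 (by positivity : 0 < 1 / 2 / γ))] with t ht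
  have hc : minTime F K x₀ < (r + t : ℝ) := by
    rw [hr]
    exact_mod_cast (by linarith [ht.1] : r < r + t)
  obtain ⟨T, hT, hTc, hrT, x, hx, hxK⟩ := exists_isTrajectory_of_minTime_lt hx₀ hc
  have hrT' : r ≤ T := by
    rw [hr] at hrT
    exact_mod_cast hrT
  have htT : t ∈ Icc 0 T := ⟨ht.1.le, (ht.2.le.trans (min_le_left _ _)).trans hrT'⟩
  have htγ : t * γ ≤ 1 / 2 := (le_div_iff₀ hγ).1 (ht.2.le.trans (min_le_right _ _))
  have hm : ∀ s ∈ Icc 0 t, ‖x s - x₀‖ ≤ A * t := fun s hs => by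
    have := hx.norm_sub_le_of_linearGrowth hγ hg x₀ htT.1 htT.2 htγ hs
    rw [sub_self, norm_zero] at this
    rw [hA]
    linarith
  have h1 := hx.minHamiltonian_sub_mul_le hF (ζ := ζ) hL.le hLip htT hm (by
    rw [hA]; nlinarith [norm_nonneg x₀])
  have h2 := h (x t) ((hx.minTime_apply_le hF hxK htT).trans
    (by exact_mod_cast (by linarith : T - t ≤ r)))
  rw [real_inner_comm] at h2
  have h3 : ‖x t - x₀‖ ^ 2 ≤ (A * t) ^ 2 := by
    have := hm t ⟨ht.1.le, le_rfl⟩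
    gcongr
  have h4 : σ * ‖x t - x₀‖ ^ 2 ≤ σ * (A * t) ^ 2 := by gcongr
  refine le_of_mul_le_mul_right ?_ ht.1
  linarith

theorem mem_horizontalProximalSubdifferential_minTime (hF : AssumptionF F)
    {x₀ ζ : EuclideanSpace ℝ (Fin n)} {r : ℝ} (hr : minTime F K x₀ = r)
    (hζ : ζ ∈ proximalNormalCone (reachableSetAt F K r) x₀) (hH : minHamiltonian F x₀ ζ = 0) :
    ζ ∈ horizontalProximalSubdifferential (minTime F K) x₀ := by
  obtain ⟨σ, hσ, h⟩ := hζ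
  obtain ⟨γ, hγ, hg⟩ := hF.linearGrowth
  -- This radius dominates `2 * d + 2 * A * δ` when `d < 1` and `4 * γ * δ < 1`.
  obtain ⟨L, hL, hLip⟩ := hF.locallyLipschitz _ (isCompact_closedBall x₀ (3 + ‖x₀‖))
  set A := 2 * (γ * (1 + ‖x₀‖)) with hA
  have hA0 : 0 < A := by positivity
  have hr0 : 0 ≤ r := by
    have := minTime_nonneg F K x₀
    rw [hr] at this
    exact_mod_cast this
  refine (mem_horizontalProximalSubdifferential_iff hr).2
    -- One summand per case: `y` in the sublevel set, `d ≥ 1`, `4 * γ * δ ≥ 1`; the last two serve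
    -- the trajectory argument.
    ⟨σ + ‖ζ‖ + 16 * γ ^ 2 * ‖ζ‖ + (σ + L * ‖ζ‖) * (8 + 8 * A ^ 2) + L * ‖ζ‖, by positivity,
      fun y β hy => ?_⟩
  set d := ‖y - x₀‖ with hd
  set δ := β - r with hδ
  have hd0 : 0 ≤ d := norm_nonneg _
  have hCS : inner ℝ ζ (y - x₀) ≤ ‖ζ‖ * d := real_inner_le_norm _ _
  have hζ0 := norm_nonneg ζ
  set Q := d ^ 2 + δ ^ 2 with hQ
  have hdQ : d ^ 2 ≤ Q := by linarith [sq_nonneg δ]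
  have hδQ : δ ^ 2 ≤ Q := by linarith [sq_nonneg d]
  have hQ0 : 0 ≤ Q := by positivity
  have n1 : 0 ≤ σ * Q := by positivity
  have n2 : 0 ≤ ‖ζ‖ * Q := by positivity
  have n3 : 0 ≤ 16 * γ ^ 2 * ‖ζ‖ * Q := by positivity
  have n4 : 0 ≤ (σ + L * ‖ζ‖) * (8 + 8 * A ^ 2) * Q := by positivity
  have n5 : 0 ≤ L * ‖ζ‖ * Q := by positivity
  simp only [add_mul _ _ Q]
  have hreach : minTime F K y ≤ r → inner ℝ ζ (y - x₀) ≤ σ * Q := fun hyr =>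
    (h y hyr).trans (by gcongr)
  rcases le_or_gt β r with hβ | hβ
  · have := hreach (hy.trans (by exact_mod_cast hβ))
    linarith
  by_cases hyK : y ∈ K
  · have := hreach (by rw [minTime_of_mem hyK]; exact_mod_cast hr0)
    linarith
  rcases le_or_gt 1 d with hd1 | hd1
  · have : ‖ζ‖ * d ≤ ‖ζ‖ * Q := by gcongr; nlinarith
    linarith
  have hδ0 : 0 < δ := sub_pos.2 hβ
  rcases le_or_gt 1 (4 * γ * δ) with hδ1 | hδ1
  · have h1 : ‖ζ‖ * d ≤ ‖ζ‖ * (16 * γ ^ 2 * Q) := by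
      gcongr
      have h2 : 1 ≤ (4 * γ * δ) ^ 2 := one_le_pow₀ hδ1
      have h3 : 16 * γ ^ 2 * δ ^ 2 ≤ 16 * γ ^ 2 * Q := by gcongr
      linarith
    linarith
  have hc : minTime F K y < (β + δ : ℝ) :=
    hy.trans_lt (by exact_mod_cast (by linarith : β < β + δ))
  obtain ⟨T, hT, hTc, -, x, hx, hxK⟩ := exists_isTrajectory_of_minTime_lt hyK hc
  -- Since `T < β + δ = r + 2 * δ`, at most time `r` remains after `2 * δ`; if `T` is smaller, the
  -- target is already reached.
  set t := min T (2 * δ) with ht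
  have ht0 : 0 ≤ t := by positivity
  have htT : t ∈ Icc 0 T := ⟨ht0, min_le_left _ _⟩
  have ht2 : t ≤ 2 * δ := min_le_right _ _
  have htr : T - t ≤ r := by
    rcases min_choice T (2 * δ) with h' | h' <;> rw [ht, h'] <;> linarith
  have htγ' : t * γ ≤ 2 * δ * γ := by gcongr
  have htγ : t * γ ≤ 1 / 2 := by linarith
  set m := 2 * d + 2 * A * δ with hm
  have hxm : ∀ s ∈ Icc 0 t, ‖x s - x₀‖ ≤ m := fun s hs => by
    have h1 := hx.norm_sub_le_of_linearGrowth hγ hg x₀ ht0 htT.2 htγ hs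
    have h2 : t * γ * (1 + ‖x₀‖) ≤ 2 * δ * γ * (1 + ‖x₀‖) := by gcongr
    rw [hm, hA]
    linarith
  have hm0 : 0 ≤ m := by positivity
  have hmR : m ≤ 3 + ‖x₀‖ := by
    have : 4 * γ * δ * (1 + ‖x₀‖) ≤ 1 * (1 + ‖x₀‖) := by gcongr
    rw [hm, hA]
    linarith
  have h1 := hx.minHamiltonian_sub_mul_le hF (ζ := ζ) hL.le hLip htT hxm hmR
  rw [hH, zero_sub, real_inner_comm] at h1
  have h2 := h (x t) ((hx.minTime_apply_le hF hxK htT).trans (by exact_mod_cast htr))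
  have h3 : ‖x t - x₀‖ ^ 2 ≤ m ^ 2 := by
    have := hxm t ⟨ht0, le_rfl⟩
    gcongr
  have h4 : σ * ‖x t - x₀‖ ^ 2 ≤ σ * m ^ 2 := by gcongr
  have h5 : L * m * ‖ζ‖ * t ≤ L * m * ‖ζ‖ * (2 * δ) := by gcongr
  have h6 : inner ℝ ζ (y - x₀) = inner ℝ ζ (x t - x₀) - inner ℝ ζ (x t - y) := by
    rw [← inner_sub_right]; congr 1; abel
  have h7 : L * ‖ζ‖ * (2 * m * δ) ≤ L * ‖ζ‖ * (m ^ 2 + δ ^ 2) := by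
    gcongr; exact two_mul_le_add_sq m δ
  have h8 : m ^ 2 ≤ (8 + 8 * A ^ 2) * Q := by
    have e1 : 0 ≤ A ^ 2 * d ^ 2 := by positivity
    have e2 : m ^ 2 ≤ 2 * ((2 * d) ^ 2 + (2 * A * δ) ^ 2) := add_sq_le
    have e3 := sq_nonneg δ
    rw [hQ]
    linarith
  have h9 : (σ + L * ‖ζ‖) * m ^ 2 ≤ (σ + L * ‖ζ‖) * ((8 + 8 * A ^ 2) * Q) := by gcongr
  have h10 : L * ‖ζ‖ * δ ^ 2 ≤ L * ‖ζ‖ * Q := by gcongr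
  linarith

theorem mainTheorem6 {n : ℕ}
    (F : EuclideanSpace ℝ (Fin n) → Set (EuclideanSpace ℝ (Fin n))) (hF : AssumptionF F)
    (K : Set (EuclideanSpace ℝ (Fin n))) (hK : IsClosed K)
    (x₀ : EuclideanSpace ℝ (Fin n)) (hx₀ : x₀ ∈ reachableSet F K \ K) :
    horizontalProximalSubdifferential (minTime F K) x₀ =
      proximalNormalCone (reachableSetAt F K (minTime F K x₀)) x₀ ∩
        {ζ | minHamiltonian F x₀ ζ = 0} := by
  obtain ⟨r, hr⟩ : ∃ r : ℝ, minTime F K x₀ = r := by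
    have h0 : minTime F K x₀ ≠ ⊥ := fun h => by
      have := minTime_nonneg F K x₀
      simp [h] at this
    exact ⟨_, (EReal.coe_toReal hx₀.1.ne h0).symm⟩
  rw [hr]
  ext ζ
  constructor
  · intro hζ
    have hN : ζ ∈ proximalNormalCone (reachableSetAt F K r) x₀ := by
      obtain ⟨σ, hσ, h⟩ := (mem_horizontalProximalSubdifferential_iff hr).1 hζ
      exact ⟨σ, hσ, fun y hy => by simpa using h y r hy⟩
    exact ⟨hN, le_antisymm (minHamiltonian_nonpos hF hK hx₀.2 hr hN)
      (minHamiltonian_nonneg hF hr hζ)⟩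
  · rintro ⟨hN, hH⟩
    exact mem_horizontalProximalSubdifferential_minTime hF hr hN hH
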